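/- **Setting.** For a sequence $\alpha=(\alpha_k)_{k\in\mathbb N}$ of positive reals and $1\le p<\infty$ let $\ell^p_\alpha=\{x\in\mathbb R^{\mathbb N}:\|x\|_{\ell^p_\alpha}<\infty\}$, where $\|x\|_{\ell^p_\alpha}=\bigl(\sum_k|x_k/\alpha_k|^p\bigr)^{1/p}$. Fix $1\le p<\infty$, sequences $\alpha,\gamma$ of positive reals, $X=\ell^p_\alpha$ with open balls $B(h,r)$, and $m\in X$. Let $\mu_0$ be a probability measure on $\mathbb R$ with a Lebesgue density $\rho:\mathbb R\to(0,\infty)$ that is continuous, symmetric ($\rho(-x)=\rho(x)$) and non-increasing on $[0,\infty)$. Let $\mu=\bigotimes_{k}\mu_k$ on $\mathbb R^{\mathbb N}$, where $\mu_k$ is the law of $m_k+\gamma_k u$ with $u\sim\mu_0$, and assume $\mu(X)=1$. Put $$\mathfrak q(x)=-\log\frac{\rho(x)}{\rho(0)},\qquad \mathfrak q_{\gamma,m}(h)=\sum_{k}\mathfrak q\Bigl(\frac{h_k-m_k}{\gamma_k}\Bigr)\in[0,\infty],\qquad E_{\gamma,m}=\{h\in\mathbb R^{\mathbb N}:\mathfrak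 q_{\gamma,m}(h)<\infty\}.$$ **Theorem.** 1. For every $h\in X$, $$\liminf_{r\searrow0}\,-\log\frac{\mu(B(h,r))}{\mu(B(m,r))}\ \ge\ \mathfrak q_{\gamma,m}(h),$$ and if $h\notin E_{\gamma,m}$, then $\lim_{r\searrow0}-\log\frac{\mu(B(h,r))}{\mu(B(m,r))}=+\infty$. 2. Assume in addition that either (i) $\rho\in C^2(\mathbb R)$ and $\rho''\in L^1(\mathbb R)$, or (ii) $\rho(x)\propto\exp(-|x|^s)$ for some $s\in[1,2]$. Then every $h\in E_{\gamma,m}$ with $h-m\in\ell^2_\gamma$ lies in $X$ and satisfies $$\limsup_{r\searrow0}\,-\log\frac{\mu(B(h,r))}{\mu(B(m,r))}\ \le\ \mathfrak q_{\gamma,m}(h).$$ Consequently $\mathfrak q_{\gamma,m}$ is an Onsager–Machlup functional for $\mu$ on $E=E_{\gamma,m}\cap(m+\ell^2_\gamma)$: the set $E$ is non-empty, every ball $B(x,r)$ with $x\in E$ and $r>0$ has positive $\mu$-measure, and $$\lim_{r\searrow0}\frac{\mu(B(x_1,r))}{\mu(B(x_2,r))}=\exp\bigl(\mathfrak q_{\gamma,m}(x_2)-\mathfrak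 q_{\gamma,m}(x_1)\bigr)\qquad\text{for all }x_1,x_2\in E.$$ -/

import Mathlib

open Filter Topology MeasureTheory
open scoped ENNReal

namespace ProductOM

noncomputable section

/-- The weighted sequence norm `(∑ₖ |xₖ / αₖ| ^ p) ^ (1 / p)`, with values in `[0, ∞]`. -/
def weightedNorm (p : ℝ) (α x : ℕ → ℝ) : ℝ≥0∞ :=
  (∑' k, ENNReal.ofReal |x k / α k| ^ p) ^ (1 / p)

/-- The weighted sequence space `ℓ^p_α`, as a set of real sequences. -/
def weightedLp (p : ℝ) (α : ℕ → ℝ) : Set (ℕ → ℝ) :=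
  {x | weightedNorm p α x < ∞}

/-- The open ball of radius `r` around `h` in the norm of `ℓ^p_α`. For `h ∈ ℓ^p_α` it is contained
in `ℓ^p_α`. -/
def weightedBall (p : ℝ) (α h : ℕ → ℝ) (r : ℝ) : Set (ℕ → ℝ) :=
  {x | weightedNorm p α (x - h) < ENNReal.ofReal r}

/-- The product, over `k`, of the laws of `γₖ u + mₖ` where `u` has law `μ₀`. -/
def productMeasure (μ₀ : Measure ℝ) (γ m : ℕ → ℝ) : Measure (ℕ → ℝ) :=
  Measure.infinitePi (fun k => μ₀.map (fun u : ℝ => γ k * u + m k))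

/-- The normalised negative log-density `q(x) = -log (ρ x / ρ 0)`. -/
def negLogDensity (ρ : ℝ → ℝ) (x : ℝ) : ℝ :=
  -Real.log (ρ x / ρ 0)

/-- The functional `q_{γ,m}(h) = ∑ₖ q((hₖ - mₖ) / γₖ)`, with values in `[0, ∞]`. (The terms are
nonnegative as soon as `ρ` is positive and has its maximum at `0`.) -/
def formalNegLogDensity (ρ : ℝ → ℝ) (γ m h : ℕ → ℝ) : ℝ≥0∞ :=
  ∑' k, ENNReal.ofReal (negLogDensity ρ ((h k - m k) / γ k))

/-- The set `E_{γ,m}` of sequences where `q_{γ,m}` is finite. -/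
def finiteSet (ρ : ℝ → ℝ) (γ m : ℕ → ℝ) : Set (ℕ → ℝ) :=
  {h | formalNegLogDensity ρ γ m h < ∞}

/-- `-log (μ(B(h,r)) / μ(B(m,r)))`, with values in `[-∞, ∞]`. -/
def negLogBallRatio (p : ℝ) (α : ℕ → ℝ) (μ : Measure (ℕ → ℝ)) (h m : ℕ → ℝ) (r : ℝ) : EReal :=
  -ENNReal.log (μ (weightedBall p α h r) / μ (weightedBall p α m r))

/-- `I` is an Onsager–Machlup functional on `E` for the measure `μ` on `ℓ^p_α`: the set `E` is a
nonempty subset of the support of `μ` in `ℓ^p_α`, and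
`μ(B(x₁,r)) / μ(B(x₂,r)) → exp (I x₂ - I x₁)` as `r ↘ 0`, for all `x₁, x₂ ∈ E`. -/
structure IsOnsagerMachlup (p : ℝ) (α : ℕ → ℝ) (μ : Measure (ℕ → ℝ)) (E : Set (ℕ → ℝ))
    (I : (ℕ → ℝ) → ℝ) : Prop where
  nonempty : E.Nonempty
  subset_space : E ⊆ weightedLp p α
  subset_support : ∀ x ∈ E, ∀ r : ℝ, 0 < r → 0 < μ (weightedBall p α x r)
  tendsto_ratio : ∀ x₁ ∈ E, ∀ x₂ ∈ E,
    Tendsto (fun r : ℝ => μ.real (weightedBall p α x₁ r) / μ.real (weightedBall p α x₂ r))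
      (𝓝[>] 0) (𝓝 (Real.exp (I x₂ - I x₁)))

end

end ProductOM

/-!
Balls around different centres are compared by moving the centre one coordinate at a time. Slicing
`B(h, r)` along the `k`-th coordinate, with the others fixed, gives an interval centred at `h k`
whose half-width is at most `α k * r` and does not depend on `h k`
(`exists_measure_weightedBall_update_eq_lintegral`). Since `μ` is invariant under resampling a
coordinate, any inequality `μ₀ (ball t a) ≤ c * μ₀ (ball 0 a)`, or its reverse, that holds for
`t = (h k - m k) / γ k` and all `a ≤ α k * r / γ k` passes to the measures of `B(h, r)` and of the
ball whose centre has `m k` in place of `h k`. Three facts about the line are used: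

* by continuity of `ρ`, small intervals satisfy both inequalities with `c` close to `exp (-q t)`
  (`exists_forall_measure_ball_bounds`);
* since `ρ` is symmetric and unimodal, `μ₀ (ball t a) ≤ μ₀ (ball 0 a)` for all `a`
  (`intervalMass_le_intervalMass_zero`);
* under the additional hypotheses, `μ₀ (ball t a) ≥ (1 - C (t ^ 2 + q t)) μ₀ (ball 0 a)` for
  `|t| ≤ 1`, uniformly in `a` (`HasSecondOrderBound`). For `ρ ∈ C²` with `ρ'' ∈ L¹` this is Taylor's
  formula for `t ↦ μ₀ (ball t a)`, whose second derivative is at most a multiple of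
  `min a 1`, hence of `μ₀ (ball 0 a)`. For `ρ ∝ exp (-|x| ^ s)` it follows from
  `(|u + t| ^ s + |u - t| ^ s) / 2 ≤ |u| ^ s + |t| ^ s` and the convexity of `exp`.

The first fact for the coordinates below `N` and the second for the others bound `μ(B(h, r))` above;
the first and the third bound it below when `∑ (t k ^ 2 + q (t k)) < ∞`. These bounds are obtained
for shifts of `m` with finitely many nonzero coordinates and are uniform in their number; they
extend to `h` by the triangle inequality, because the truncated shifts converge in `ℓ^p_α`.

That `h` lies in `ℓ^p_α` in the second part comes from the same lower bound: otherwise the truncated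
centres would leave every ball around `m`, while the balls around them keep a fixed mass
(`sub_mem_weightedLp_of_le_measure_splice`).
-/

namespace ProductOM

/-! ### Masses of translated intervals on the line -/

/-- The integral of `ρ` over the interval of half-width `a` centred at `t`. -/
noncomputable def intervalMass (ρ : ℝ → ℝ) (a t : ℝ) : ℝ := ∫ x in (t - a)..(t + a), ρ x

lemma intervalMass_eq_integral_add (ρ : ℝ → ℝ) (a t : ℝ) :
    intervalMass ρ a t = ∫ u in (-a)..a, ρ (u + t) := by
  rw [intervalIntegral.integral_comp_add_right, intervalMass]
  congr 1 <;> ring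

lemma intervalMass_neg {ρ : ℝ → ℝ} (hs : ∀ x, ρ (-x) = ρ x) (a t : ℝ) :
    intervalMass ρ a (-t) = intervalMass ρ a t := by
  have h := intervalIntegral.integral_comp_neg (a := t - a) (b := t + a) ρ
  simp only [hs] at h
  rw [intervalMass, intervalMass, h]
  congr 1 <;> ring

lemma hasDerivAt_intervalMass {ρ : ℝ → ℝ} (hc : Continuous ρ) (a t : ℝ) :
    HasDerivAt (intervalMass ρ a) (ρ (t + a) - ρ (t - a)) t := by
  have h0 : ∀ s, HasDerivAt (fun y => ∫ x in (0 : ℝ)..y, ρ x) (ρ s) s := fun s =>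
    intervalIntegral.integral_hasDerivAt_right (hc.intervalIntegrable _ _)
      (hc.stronglyMeasurableAtFilter _ _) hc.continuousAt
  have h1 := ((h0 (t + a)).comp_add_const t a).sub ((h0 (t - a)).comp_sub_const t a)
  refine h1.congr_of_eventuallyEq (Eventually.of_forall fun s => ?_)
  simp only [intervalMass, Pi.sub_apply]
  rw [intervalIntegral.integral_interval_sub_left] <;> exact hc.intervalIntegrable _ _

lemma le_of_abs_le_abs {ρ : ℝ → ℝ} (hs : ∀ x, ρ (-x) = ρ x) (ha : AntitoneOn ρ (Set.Ici 0))
    {x y : ℝ} (h : |x| ≤ |y|) : ρ y ≤ ρ x := by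
  have habs : ∀ z, ρ |z| = ρ z := fun z => by
    rcases abs_choice z with h | h <;> rw [h]
    exact hs z
  rw [← habs x, ← habs y]
  exact ha (abs_nonneg x) (abs_nonneg y) h

/-- Among intervals of a given length, the centred one has the largest mass. -/
lemma intervalMass_le_intervalMass_zero {ρ : ℝ → ℝ} (hc : Continuous ρ) (hs : ∀ x, ρ (-x) = ρ x)
    (ha : AntitoneOn ρ (Set.Ici 0)) {a : ℝ} (ha0 : 0 ≤ a) (t : ℝ) :
    intervalMass ρ a t ≤ intervalMass ρ a 0 := by
  have key : AntitoneOn (intervalMass ρ a) (Set.Ici 0) := by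
    refine antitoneOn_of_deriv_nonpos (convex_Ici 0)
      (fun x _ => (hasDerivAt_intervalMass hc a x).continuousAt.continuousWithinAt)
      (fun x _ => (hasDerivAt_intervalMass hc a x).differentiableAt.differentiableWithinAt)
      fun x hx => ?_
    rw [interior_Ici, Set.mem_Ioi] at hx
    rw [(hasDerivAt_intervalMass hc a x).deriv, sub_nonpos]
    refine le_of_abs_le_abs hs ha ?_
    rw [abs_of_nonneg (add_nonneg hx.le ha0), abs_le]
    constructor <;> linarith
  rcases le_total 0 t with h | h
  · exact key Set.self_mem_Ici h h
  · rw [← intervalMass_neg hs]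
    exact key Set.self_mem_Ici (neg_nonneg.2 h) (neg_nonneg.2 h)

lemma intervalMass_le_mul {ρ : ℝ → ℝ} (hc : Continuous ρ) {a t c : ℝ} (ha0 : 0 ≤ a)
    (h : ∀ u, |u| ≤ a → ρ (u + t) ≤ c * ρ u) :
    intervalMass ρ a t ≤ c * intervalMass ρ a 0 := by
  simp only [intervalMass_eq_integral_add, add_zero]
  rw [← intervalIntegral.integral_const_mul]
  refine intervalIntegral.integral_mono_on (by linarith) ?_ ?_ fun u hu => h u (abs_le.2 hu)
  · exact (by fun_prop : Continuous fun u => ρ (u + t)).intervalIntegrable _ _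
  · exact (by fun_prop : Continuous fun u => c * ρ u).intervalIntegrable _ _

lemma mul_le_intervalMass {ρ : ℝ → ℝ} (hc : Continuous ρ) {a t c : ℝ} (ha0 : 0 ≤ a)
    (h : ∀ u, |u| ≤ a → c * ρ u ≤ ρ (u + t)) :
    c * intervalMass ρ a 0 ≤ intervalMass ρ a t := by
  simp only [intervalMass_eq_integral_add, add_zero]
  rw [← intervalIntegral.integral_const_mul]
  refine intervalIntegral.integral_mono_on (by linarith) ?_ ?_ fun u hu => h u (abs_le.2 hu)
  · exact (by fun_prop : Continuous fun u => c * ρ u).intervalIntegrable _ _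
  · exact (by fun_prop : Continuous fun u => ρ (u + t)).intervalIntegrable _ _

/-- For symmetric `ρ`, the mass of a translated interval is the integral of the symmetrised
translate, so a bound on the latter is enough. -/
lemma mul_le_intervalMass_of_symm {ρ : ℝ → ℝ} (hc : Continuous ρ) (hs : ∀ x, ρ (-x) = ρ x)
    {a t c : ℝ} (ha0 : 0 ≤ a) (h : ∀ u, c * ρ u ≤ (ρ (u + t) + ρ (u + -t)) / 2) :
    c * intervalMass ρ a 0 ≤ intervalMass ρ a t := by
  have i1 : IntervalIntegrable (fun u => ρ (u + t)) volume (-a) a :=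
    (by fun_prop : Continuous fun u => ρ (u + t)).intervalIntegrable _ _
  have i2 : IntervalIntegrable (fun u => ρ (u + -t)) volume (-a) a :=
    (by fun_prop : Continuous fun u => ρ (u + -t)).intervalIntegrable _ _
  have hD : intervalMass ρ a t = ∫ u in (-a)..a, (ρ (u + t) + ρ (u + -t)) / 2 := by
    rw [intervalIntegral.integral_div, intervalIntegral.integral_add i1 i2,
      ← intervalMass_eq_integral_add, ← intervalMass_eq_integral_add, intervalMass_neg hs]
    ring
  rw [hD, intervalMass_eq_integral_add, ← intervalIntegral.integral_const_mul]
  simp only [add_zero]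
  refine intervalIntegral.integral_mono_on (by linarith) ?_ ?_ fun u _ => h u
  · exact (by fun_prop : Continuous fun u => c * ρ u).intervalIntegrable _ _
  · exact (by fun_prop : Continuous fun u => (ρ (u + t) + ρ (u + -t)) / 2).intervalIntegrable _ _

lemma withDensity_ball {ρ : ℝ → ℝ} (hc : Continuous ρ) (hpos : ∀ x, 0 < ρ x) {a : ℝ}
    (ha0 : 0 ≤ a) (t : ℝ) :
    volume.withDensity (fun x => ENNReal.ofReal (ρ x)) (Metric.ball t a) =
      ENNReal.ofReal (intervalMass ρ a t) := by
  rw [withDensity_apply _ Metric.isOpen_ball.measurableSet, Real.ball_eq_Ioo,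
    setLIntegral_congr Ioo_ae_eq_Ioc, intervalMass,
    intervalIntegral.integral_of_le (by linarith),
    ofReal_integral_eq_lintegral_ofReal]
  · exact (hc.integrableOn_Icc).mono_set Set.Ioc_subset_Icc_self
  · exact Eventually.of_forall fun x => (hpos x).le

/-! ### Second-order lower bounds -/

/-- The one-dimensional estimate behind the lower bound for ball masses: translating a centred
interval by a small `t` costs at most a factor `1 - O(t ^ 2 + q t)`, uniformly in its length. -/
def HasSecondOrderBound (ρ : ℝ → ℝ) : Prop :=
  ∃ C : ℝ, 0 ≤ C ∧ ∀ t, |t| ≤ 1 → ∀ a, 0 ≤ a →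
    (1 - C * (t ^ 2 + negLogDensity ρ t)) * intervalMass ρ a 0 ≤ intervalMass ρ a t

lemma negLogDensity_nonneg {ρ : ℝ → ℝ} (hpos : ∀ x, 0 < ρ x) (hs : ∀ x, ρ (-x) = ρ x)
    (ha : AntitoneOn ρ (Set.Ici 0)) (x : ℝ) : 0 ≤ negLogDensity ρ x := by
  rw [negLogDensity, neg_nonneg]
  refine Real.log_nonpos (div_pos (hpos _) (hpos _)).le ((div_le_one (hpos _)).2 ?_)
  exact le_of_abs_le_abs hs ha (by simp)

lemma exp_neg_negLogDensity {ρ : ℝ → ℝ} (hpos : ∀ x, 0 < ρ x) (x : ℝ) :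
    Real.exp (-negLogDensity ρ x) = ρ x / ρ 0 := by
  rw [negLogDensity, neg_neg, Real.exp_log (div_pos (hpos _) (hpos _))]

lemma intervalMass_nonneg {ρ : ℝ → ℝ} (hpos : ∀ x, 0 < ρ x) {a : ℝ} (ha0 : 0 ≤ a) (t : ℝ) :
    0 ≤ intervalMass ρ a t :=
  intervalIntegral.integral_nonneg (by linarith) fun x _ => (hpos x).le

/-- For `1 ≤ s ≤ 2` this interpolates between the triangle inequality and the parallelogram
law. -/
lemma abs_add_rpow_add_abs_sub_rpow_le {s : ℝ} (hs1 : 1 ≤ s) (hs2 : s ≤ 2) (u t : ℝ) :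
    (|u + t| ^ s + |u - t| ^ s) / 2 ≤ |u| ^ s + |t| ^ s := by
  have hs0 : 0 < s := by linarith
  have key : ∀ x : ℝ, |x| ^ s = (x ^ 2) ^ (s / 2) := fun x => by
    rw [← sq_abs, ← Real.rpow_natCast, ← Real.rpow_mul (abs_nonneg _)]
    congr 1
    push_cast
    ring
  have hconc := (Real.concaveOn_rpow (p := s / 2) (by linarith) (by linarith)).2
    (sq_nonneg (u + t) : (u + t) ^ 2 ∈ Set.Ici 0) (sq_nonneg (u - t) : (u - t) ^ 2 ∈ Set.Ici 0)
    (by norm_num : (0 : ℝ) ≤ 1 / 2) (by norm_num : (0 : ℝ) ≤ 1 / 2) (by norm_num)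
  have hsub := Real.rpow_add_le_add_rpow (sq_nonneg u) (sq_nonneg t)
    (by linarith : 0 ≤ s / 2) (by linarith : s / 2 ≤ 1)
  simp only [smul_eq_mul] at hconc
  rw [show 1 / 2 * (u + t) ^ 2 + 1 / 2 * (u - t) ^ 2 = u ^ 2 + t ^ 2 by ring] at hconc
  rw [key, key, key, key]
  linarith

lemma hasSecondOrderBound_of_exp_rpow {ρ : ℝ → ℝ} (hc : Continuous ρ) (hpos : ∀ x, 0 < ρ x)
    (hsymm : ∀ x, ρ (-x) = ρ x) {s c : ℝ} (hs1 : 1 ≤ s) (hs2 : s ≤ 2)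
    (hρ : ∀ x, ρ x = c * Real.exp (-(|x| ^ s))) : HasSecondOrderBound ρ := by
  have h0 : ρ 0 = c := by rw [hρ]; simp [Real.zero_rpow (by linarith : s ≠ 0)]
  have hcpos : 0 < c := h0 ▸ hpos 0
  have hq : ∀ t, negLogDensity ρ t = |t| ^ s := fun t => by
    rw [negLogDensity, h0, hρ, mul_div_cancel_left₀ _ hcpos.ne', Real.log_exp, neg_neg]
  refine ⟨1, zero_le_one, fun t _ a ha => mul_le_intervalMass_of_symm hc hsymm ha fun u => ?_⟩
  -- convexity of `exp`, at the mean of the two exponents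
  have hconv := convexOn_exp.2 (Set.mem_univ (-(|u + t| ^ s))) (Set.mem_univ (-(|u - t| ^ s)))
    (by norm_num : (0 : ℝ) ≤ 1 / 2) (by norm_num : (0 : ℝ) ≤ 1 / 2) (by norm_num)
  simp only [smul_eq_mul] at hconv
  have hle : Real.exp (-(|t| ^ s)) * Real.exp (-(|u| ^ s)) ≤
      Real.exp (1 / 2 * -(|u + t| ^ s) + 1 / 2 * -(|u - t| ^ s)) := by
    rw [← Real.exp_add]
    have := abs_add_rpow_add_abs_sub_rpow_le hs1 hs2 u t
    exact Real.exp_le_exp.2 (by linarith)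
  have hlin : 1 - 1 * (t ^ 2 + |t| ^ s) ≤ Real.exp (-(|t| ^ s)) := by
    have := Real.add_one_le_exp (-(|t| ^ s))
    nlinarith [sq_nonneg t]
  rw [hq, hρ, hρ (u + t), hρ (u + -t), ← sub_eq_add_neg]
  calc (1 - 1 * (t ^ 2 + |t| ^ s)) * (c * Real.exp (-(|u| ^ s)))
      ≤ Real.exp (-(|t| ^ s)) * (c * Real.exp (-(|u| ^ s))) := by gcongr
    _ = c * (Real.exp (-(|t| ^ s)) * Real.exp (-(|u| ^ s))) := by ring
    _ ≤ c * (1 / 2 * Real.exp (-(|u + t| ^ s)) + 1 / 2 * Real.exp (-(|u - t| ^ s))) := by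
        gcongr
        exact hle.trans hconv
    _ = _ := by ring

/-- A crude second-order Taylor estimate at a critical point. -/
lemma abs_sub_le_of_abs_deriv2_le {f f' f'' : ℝ → ℝ} {B t : ℝ} (hf : ∀ x, HasDerivAt f (f' x) x)
    (hf' : ∀ x, HasDerivAt f' (f'' x) x) (h0 : f' 0 = 0) (hB : ∀ x, |x| ≤ |t| → |f'' x| ≤ B) :
    |f t - f 0| ≤ B * t ^ 2 := by
  have hconv : Convex ℝ (Metric.closedBall (0 : ℝ) |t|) := convex_closedBall _ _
  have hmem : ∀ x : ℝ, x ∈ Metric.closedBall (0 : ℝ) |t| ↔ |x| ≤ |t| := fun x => by simp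
  have hB0 : 0 ≤ B := (abs_nonneg _).trans (hB 0 (by simp))
  have h1 : ∀ x, |x| ≤ |t| → |f' x| ≤ B * |t| := fun x hx => by
    have := hconv.norm_image_sub_le_of_norm_hasDerivWithin_le (f := f') (C := B)
      (fun y _ => (hf' y).hasDerivWithinAt) (fun y hy => hB y ((hmem y).1 hy))
      ((hmem 0).2 (by simp)) ((hmem x).2 hx)
    rw [h0, sub_zero, sub_zero, Real.norm_eq_abs, Real.norm_eq_abs] at this
    exact this.trans (by gcongr)
  have := hconv.norm_image_sub_le_of_norm_hasDerivWithin_le (f := f) (C := B * |t|)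
    (fun y _ => (hf y).hasDerivWithinAt) (fun y hy => h1 y ((hmem y).1 hy))
    ((hmem 0).2 (by simp)) ((hmem t).2 le_rfl)
  rwa [sub_zero, Real.norm_eq_abs, Real.norm_eq_abs, mul_assoc, ← sq, sq_abs] at this

lemma hasSecondOrderBound_of_contDiff {ρ : ℝ → ℝ} (hpos : ∀ x, 0 < ρ x)
    (hsymm : ∀ x, ρ (-x) = ρ x) (hanti : AntitoneOn ρ (Set.Ici 0)) (h2 : ContDiff ℝ 2 ρ)
    (hint : Integrable (deriv (deriv ρ)) volume) : HasSecondOrderBound ρ := by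
  have hc := h2.continuous
  have hd : Differentiable ℝ ρ := h2.differentiable (by norm_num)
  have h2' : ContDiff ℝ 1 (deriv ρ) := ((contDiff_succ_iff_deriv (n := 1)).1 h2).2.2
  have hd' : Differentiable ℝ (deriv ρ) := h2'.differentiable (by norm_num)
  have hc'' : Continuous (deriv (deriv ρ)) := h2'.continuous_deriv le_rfl
  set K₁ := ∫ x, |deriv (deriv ρ) x|
  have hK₁ : ∀ x y, |deriv ρ x - deriv ρ y| ≤ K₁ := fun x y => by
    rw [← intervalIntegral.integral_deriv_eq_sub (fun z _ => hd' z) (hc''.intervalIntegrable _ _)]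
    calc |∫ z in y..x, deriv (deriv ρ) z| ≤ ∫ z in Set.uIoc y x, |deriv (deriv ρ) z| :=
          intervalIntegral.norm_integral_le_integral_norm_uIoc (f := deriv (deriv ρ))
            (μ := volume)
      _ ≤ K₁ := setIntegral_le_integral hint.abs (Eventually.of_forall fun z => abs_nonneg _)
  obtain ⟨K₂, hK₂⟩ := (isCompact_closedBall (0 : ℝ) 2).exists_bound_of_continuousOn
    hc''.continuousOn
  have hK₂' : ∀ x y, |x| ≤ 2 → |y| ≤ 2 → |deriv ρ x - deriv ρ y| ≤ K₂ * |x - y| :=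
    fun x y hx hy => (convex_closedBall (0 : ℝ) 2).norm_image_sub_le_of_norm_hasDerivWithin_le
      (fun z _ => (hd' z).hasDerivAt.hasDerivWithinAt) hK₂ (by simpa using hy) (by simpa using hx)
  have hK₁0 : 0 ≤ K₁ := (abs_nonneg _).trans (hK₁ 0 0)
  have hK₂0 : 0 ≤ K₂ := (norm_nonneg _).trans (hK₂ 0 (by simp))
  set C := (K₁ + 2 * K₂) / (2 * ρ 1)
  have hρ1 := hpos 1
  have hC0 : 0 ≤ C := by positivity
  refine ⟨C, hC0, fun t ht a ha => ?_⟩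
  -- a centred interval of half-width `a` has mass at least `2 ρ(1) min(a, 1)`
  have hmass : 2 * ρ 1 * min a 1 ≤ intervalMass ρ a 0 := by
    have hm0 : 0 ≤ min a 1 := le_min ha zero_le_one
    calc 2 * ρ 1 * min a 1 = ∫ _ in (-(min a 1))..(min a 1), ρ 1 := by
          rw [intervalIntegral.integral_const, smul_eq_mul]; ring
      _ ≤ ∫ x in (-(min a 1))..(min a 1), ρ x := by
          refine intervalIntegral.integral_mono_on (by linarith) (by simp)
            (hc.intervalIntegrable _ _) fun x hx => le_of_abs_le_abs hsymm hanti ?_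
          rw [abs_one]
          exact (abs_le.2 hx).trans (min_le_right _ _)
      _ ≤ ∫ x in (0 - a)..(0 + a), ρ x := by
          refine intervalIntegral.integral_mono_interval (by linarith [min_le_left a 1])
            (by linarith) (by linarith [min_le_left a 1])
            (Eventually.of_forall fun x => (hpos x).le) (hc.intervalIntegrable _ _)
  have hbound : ∀ x, |x| ≤ |t| →
      |deriv ρ (x + a) - deriv ρ (x - a)| ≤ C * intervalMass ρ a 0 := fun x hx => by
    have h1 : |deriv ρ (x + a) - deriv ρ (x - a)| ≤ (K₁ + 2 * K₂) * min a 1 := by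
      rcases le_total a 1 with h | h
      · rw [min_eq_left h]
        have hx1 := abs_le.1 (hx.trans ht)
        have := hK₂' (x + a) (x - a) (abs_le.2 (by constructor <;> linarith))
          (abs_le.2 (by constructor <;> linarith))
        rw [show x + a - (x - a) = 2 * a by ring, abs_of_nonneg (by linarith : 0 ≤ 2 * a)] at this
        nlinarith [mul_nonneg hK₁0 ha]
      · rw [min_eq_right h]
        linarith [hK₁ (x + a) (x - a)]
    calc _ ≤ (K₁ + 2 * K₂) * min a 1 := h1
      _ = C * (2 * ρ 1 * min a 1) := by simp only [C]; field_simp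
      _ ≤ _ := by gcongr
  have key := abs_sub_le_of_abs_deriv2_le (t := t) (hasDerivAt_intervalMass hc a)
    (fun x => ((hd (x + a)).hasDerivAt.comp_add_const x a).sub
      ((hd (x - a)).hasDerivAt.comp_sub_const x a))
    (by rw [zero_add, zero_sub, hsymm, sub_self]) hbound
  have hq := negLogDensity_nonneg hpos hsymm hanti t
  have h0 := intervalMass_nonneg hpos ha 0
  nlinarith [(abs_le.1 key).1, mul_nonneg (mul_nonneg hC0 hq) h0]

/-! ### Resampling one coordinate -/

lemma measurePreserving_update (ν : ℕ → Measure ℝ) [∀ k, IsProbabilityMeasure (ν k)] (k : ℕ) :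
    MeasurePreserving (fun q : (ℕ → ℝ) × ℝ => Function.update q.1 k q.2)
      ((Measure.infinitePi ν).prod (ν k)) (Measure.infinitePi ν) := by
  classical
  have hmeas : Measurable fun q : (ℕ → ℝ) × ℝ => Function.update q.1 k q.2 :=
    measurable_pi_lambda _ fun j => by
      by_cases hj : j = k
      · subst hj
        simpa using measurable_snd
      · simp only [Function.update_of_ne hj]
        exact (measurable_pi_apply j).comp measurable_fst
  refine ⟨hmeas, Measure.eq_infinitePi ν fun s t ht => ?_⟩
  rw [Measure.map_apply hmeas (MeasurableSet.pi s.countable_toSet fun i _ => ht i)]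
  have hpre : (fun q : (ℕ → ℝ) × ℝ => Function.update q.1 k q.2) ⁻¹' (Set.pi s t) =
      (Set.pi (s.erase k : Finset ℕ) t) ×ˢ (if k ∈ s then t k else Set.univ) := by
    ext q
    simp only [Set.mem_preimage, Set.mem_pi, Set.mem_prod, Finset.mem_coe, Finset.mem_erase]
    constructor
    · refine fun h => ⟨fun i hi => by simpa [Function.update_of_ne hi.1] using h i hi.2, ?_⟩
      split_ifs with hk
      · simpa using h k hk
      · trivial
    · rintro ⟨h1, h2⟩ i hi
      by_cases hik : i = k
      · subst hik
        simpa [hi] using h2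
      · simpa [Function.update_of_ne hik] using h1 i ⟨hik, hi⟩
  rw [hpre, Measure.prod_prod, Measure.infinitePi_pi _ fun i _ => ht i]
  split_ifs with hk
  · exact Finset.prod_erase_mul s (fun i => ν i (t i)) hk
  · rw [measure_univ, mul_one, Finset.erase_eq_of_notMem hk]

lemma infinitePi_eq_lintegral_update (ν : ℕ → Measure ℝ) [∀ k, IsProbabilityMeasure (ν k)] (k : ℕ)
    {A : Set (ℕ → ℝ)} (hA : MeasurableSet A) :
    Measure.infinitePi ν A =
      ∫⁻ x, ν k {y | Function.update x k y ∈ A} ∂Measure.infinitePi ν := by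
  have h := measurePreserving_update ν k
  rw [← h.measure_preimage hA.nullMeasurableSet, Measure.prod_apply (h.measurable hA)]
  rfl

/-! ### Weighted balls -/

lemma measurable_tsum_comp_eval {G : ℕ → ℝ → ℝ≥0∞} (hG : ∀ k, Measurable (G k)) :
    Measurable fun x : ℕ → ℝ => ∑' k, G k (x k) :=
  Measurable.tsum fun k => (hG k).comp (measurable_pi_apply k)

lemma mem_weightedBall_iff {p : ℝ} (hp : 0 < p) {α h x : ℕ → ℝ} {r : ℝ} :
    x ∈ weightedBall p α h r ↔
      ∑' k, ENNReal.ofReal |(x k - h k) / α k| ^ p < ENNReal.ofReal r ^ p := by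
  rw [weightedBall, Set.mem_ofPred_eq, weightedNorm, one_div, ENNReal.rpow_inv_lt_iff hp]
  rfl

lemma mem_weightedLp_iff {p : ℝ} (hp : 0 < p) {α x : ℕ → ℝ} :
    x ∈ weightedLp p α ↔ ∑' k, ENNReal.ofReal |x k / α k| ^ p < ∞ := by
  rw [weightedLp, Set.mem_ofPred_eq, weightedNorm, one_div, ENNReal.rpow_inv_lt_iff hp,
    ENNReal.top_rpow_of_pos hp]

lemma weightedNorm_add_le {p : ℝ} (hp : 1 ≤ p) {α : ℕ → ℝ} (x y : ℕ → ℝ) :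
    weightedNorm p α (x + y) ≤ weightedNorm p α x + weightedNorm p α y := by
  have h := ENNReal.lintegral_Lp_add_le (μ := Measure.count (α := ℕ))
    (f := fun k => ENNReal.ofReal |x k / α k|) (g := fun k => ENNReal.ofReal |y k / α k|)
    measurable_from_nat.aemeasurable measurable_from_nat.aemeasurable hp
  simp only [lintegral_count] at h
  refine le_trans ?_ h
  have hp0 : 0 ≤ p := by linarith
  refine ENNReal.rpow_le_rpow (ENNReal.tsum_le_tsum fun k => ENNReal.rpow_le_rpow ?_ hp0)
    (by positivity)
  rw [Pi.add_apply, Pi.add_apply, ← ENNReal.ofReal_add (abs_nonneg _) (abs_nonneg _), add_div]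
  exact ENNReal.ofReal_le_ofReal (abs_add_le _ _)

lemma weightedNorm_neg (p : ℝ) (α x : ℕ → ℝ) : weightedNorm p α (-x) = weightedNorm p α x := by
  simp [weightedNorm, neg_div]

lemma add_mem_weightedLp {p : ℝ} (hp : 1 ≤ p) {α x y : ℕ → ℝ} (hx : x ∈ weightedLp p α)
    (hy : y ∈ weightedLp p α) : x + y ∈ weightedLp p α :=
  (weightedNorm_add_le hp x y).trans_lt (ENNReal.add_lt_top.2 ⟨hx, hy⟩)

lemma sub_mem_weightedLp {p : ℝ} (hp : 1 ≤ p) {α x y : ℕ → ℝ} (hx : x ∈ weightedLp p α)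
    (hy : y ∈ weightedLp p α) : x - y ∈ weightedLp p α := by
  rw [sub_eq_add_neg]
  refine add_mem_weightedLp hp hx ?_
  rw [weightedLp, Set.mem_ofPred_eq, weightedNorm_neg]
  exact hy

lemma measurableSet_weightedBall {p : ℝ} (hp : 0 < p) (α h : ℕ → ℝ) (r : ℝ) :
    MeasurableSet (weightedBall p α h r) := by
  have : weightedBall p α h r =
      {x | ∑' k, ENNReal.ofReal |(x k - h k) / α k| ^ p < ENNReal.ofReal r ^ p} :=
    Set.ext fun x => mem_weightedBall_iff hp
  rw [this]
  exact measurableSet_lt (measurable_tsum_comp_eval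
    (G := fun k y => ENNReal.ofReal |(y - h k) / α k| ^ p) fun k => by fun_prop) measurable_const

lemma weightedBall_mono (p : ℝ) (α h : ℕ → ℝ) {r r' : ℝ} (hr : r ≤ r') :
    weightedBall p α h r ⊆ weightedBall p α h r' := fun _ hx =>
  lt_of_lt_of_le hx (ENNReal.ofReal_le_ofReal hr)

lemma weightedBall_subset_of_norm_add_le {p : ℝ} (hp : 1 ≤ p) {α h h' : ℕ → ℝ} {r r' : ℝ}
    (hle : weightedNorm p α (h' - h) + ENNReal.ofReal r ≤ ENNReal.ofReal r') :
    weightedBall p α h' r ⊆ weightedBall p α h r' := fun x hx => by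
  have hne : weightedNorm p α (h' - h) ≠ ∞ := fun h => by simp [h] at hle
  calc weightedNorm p α (x - h) = weightedNorm p α ((h' - h) + (x - h')) := by congr 1; abel
    _ ≤ weightedNorm p α (h' - h) + weightedNorm p α (x - h') := weightedNorm_add_le hp _ _
    _ < weightedNorm p α (h' - h) + ENNReal.ofReal r := ENNReal.add_lt_add_left hne hx
    _ ≤ _ := hle

/-- Weighted balls are open in their radius, so their measure is continuous from below in `r`. -/
lemma mul_measure_weightedBall_le_of_forall_lt {p : ℝ} {α h : ℕ → ℝ} {r : ℝ}
    (hr : 0 < r) (μ : Measure (ℕ → ℝ)) {c K : ℝ≥0∞}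
    (hK : ∀ r', 0 < r' → r' < r → c * μ (weightedBall p α h r') ≤ K) :
    c * μ (weightedBall p α h r) ≤ K := by
  obtain ⟨u, hu, hmem, hlim⟩ := exists_seq_strictMono_tendsto' hr
  have hU : weightedBall p α h r = ⋃ n, weightedBall p α h (u n) := by
    refine Set.Subset.antisymm (fun x hx => ?_)
      (Set.iUnion_subset fun n => weightedBall_mono p α h (hmem n).2.le)
    have := (ENNReal.tendsto_ofReal hlim).eventually_const_lt (show _ < _ from hx)
    obtain ⟨n, hn⟩ := this.exists
    exact Set.mem_iUnion.2 ⟨n, hn⟩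
  have hmono : Monotone fun n => weightedBall p α h (u n) := fun i j hij =>
    weightedBall_mono p α h (hu.monotone hij)
  rw [hU, hmono.measure_iUnion, ENNReal.mul_iSup]
  exact iSup_le fun n => hK _ (hmem n).1 (hmem n).2

lemma setOf_rpow_lt_eq_ball {p β : ℝ} (hp : 0 < p) (hβ : 0 < β) {s : ℝ≥0∞} (hs : s ≠ ∞) (c : ℝ) :
    {y : ℝ | ENNReal.ofReal |(y - c) / β| ^ p < s} = Metric.ball c (β * (s ^ p⁻¹).toReal) := by
  ext y
  rw [Set.mem_ofPred_eq, ← ENNReal.lt_rpow_inv_iff hp, ENNReal.ofReal_lt_iff_lt_toReal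
    (abs_nonneg _) (ENNReal.rpow_ne_top_of_nonneg (by positivity) hs), abs_div, abs_of_pos hβ,
    div_lt_iff₀' hβ, Metric.mem_ball, Real.dist_eq]

/-- Slicing a ball along the `k`-th coordinate yields intervals centred at the `k`-th coordinate of
its centre, whose lengths do not depend on that coordinate. -/
lemma exists_measure_weightedBall_update_eq_lintegral {p : ℝ} (hp : 0 < p) {α : ℕ → ℝ}
    (hα : ∀ k, 0 < α k) (ν : ℕ → Measure ℝ) [∀ k, IsProbabilityMeasure (ν k)] (h : ℕ → ℝ) (k : ℕ)
    {r : ℝ} (hr : 0 < r) :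
    ∃ a : (ℕ → ℝ) → ℝ, (∀ x, 0 ≤ a x ∧ a x ≤ α k * r) ∧ ∀ c,
      Measure.infinitePi ν (weightedBall p α (Function.update h k c) r) =
        ∫⁻ x, ν k (Metric.ball c (a x)) ∂Measure.infinitePi ν := by
  set R := ENNReal.ofReal r ^ p
  have hR : R ≠ ∞ := ENNReal.rpow_ne_top_of_nonneg hp.le ENNReal.ofReal_ne_top
  set s : (ℕ → ℝ) → ℝ≥0∞ := fun x =>
    R - ∑' j, if j = k then 0 else ENNReal.ofReal |(x j - h j) / α j| ^ p
  have hs : ∀ x, s x ≤ R := fun x => tsub_le_self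
  refine ⟨fun x => α k * (s x ^ p⁻¹).toReal, fun x => ⟨by have := hα k; positivity, ?_⟩, fun c => ?_⟩
  · refine mul_le_mul_of_nonneg_left ?_ (hα k).le
    refine ENNReal.toReal_le_of_le_ofReal hr.le ?_
    rw [ENNReal.rpow_inv_le_iff hp]
    exact hs x
  · rw [infinitePi_eq_lintegral_update ν k (measurableSet_weightedBall hp _ _ _)]
    refine lintegral_congr fun x => ?_
    rw [← setOf_rpow_lt_eq_ball hp (hα k) (ne_top_of_le_ne_top hR (hs x))]
    congr 1
    ext y
    rw [Set.mem_ofPred_eq, Set.mem_ofPred_eq, mem_weightedBall_iff hp, lt_tsub_iff_right,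
      ENNReal.tsum_eq_add_tsum_ite k]
    simp only [Function.update_self]
    refine iff_of_eq (congrArg (fun z => _ + z < _) (tsum_congr fun j => ?_))
    split_ifs with hj
    · rfl
    · simp only [Function.update_of_ne hj]

/-! ### Comparing balls whose centres differ in one coordinate -/

lemma map_affine_ball (μ₀ : Measure ℝ) {g : ℝ} (hg : 0 < g) (m c a : ℝ) :
    μ₀.map (fun u : ℝ => g * u + m) (Metric.ball c a) = μ₀ (Metric.ball ((c - m) / g) (a / g)) := by
  rw [Measure.map_apply (by fun_prop) Metric.isOpen_ball.measurableSet]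
  congr 1
  ext u
  rw [Set.mem_preimage, Metric.mem_ball, Metric.mem_ball, Real.dist_eq, Real.dist_eq,
    lt_div_iff₀ hg, ← abs_of_pos hg, ← abs_mul, abs_of_pos hg]
  congr! 2
  field_simp
  ring

section Step

variable {p : ℝ} {α γ m : ℕ → ℝ} {μ₀ : Measure ℝ} [IsProbabilityMeasure μ₀]

instance isProbabilityMeasure_map_affine (γ m : ℕ → ℝ) (k : ℕ) :
    IsProbabilityMeasure (μ₀.map (fun u : ℝ => γ k * u + m k)) :=
  Measure.isProbabilityMeasure_map (by fun_prop)

instance isProbabilityMeasure_productMeasure (γ m : ℕ → ℝ) :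
    IsProbabilityMeasure (productMeasure μ₀ γ m) := by
  rw [productMeasure]
  infer_instance

/-- A comparison of one-dimensional centred and translated intervals passes to balls whose centres
differ in one coordinate. -/
lemma measure_weightedBall_le_mul_update (hp : 0 < p) (hα : ∀ k, 0 < α k) (hγ : ∀ k, 0 < γ k)
    (h : ℕ → ℝ) (k : ℕ) {r : ℝ} (hr : 0 < r) {c : ℝ≥0∞} (hc : c ≠ ∞)
    (hle : ∀ a, 0 ≤ a → a ≤ α k * r / γ k →
      μ₀ (Metric.ball ((h k - m k) / γ k) a) ≤ c * μ₀ (Metric.ball 0 a)) :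
    productMeasure μ₀ γ m (weightedBall p α h r) ≤
      c * productMeasure μ₀ γ m (weightedBall p α (Function.update h k (m k)) r) := by
  obtain ⟨a, ha, hint⟩ := exists_measure_weightedBall_update_eq_lintegral hp hα
    (fun k => μ₀.map (fun u : ℝ => γ k * u + m k)) h k hr
  have h1 := hint (h k)
  rw [Function.update_eq_self] at h1
  rw [productMeasure, h1, hint (m k), ← lintegral_const_mul' _ _ hc]
  refine lintegral_mono fun x => ?_
  have hγk := (hγ k).le
  simp only [map_affine_ball μ₀ (hγ k), sub_self, zero_div]
  exact hle _ (div_nonneg (ha x).1 hγk) (div_le_div_of_nonneg_right (ha x).2 hγk)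

lemma mul_update_le_measure_weightedBall (hp : 0 < p) (hα : ∀ k, 0 < α k) (hγ : ∀ k, 0 < γ k)
    (h : ℕ → ℝ) (k : ℕ) {r : ℝ} (hr : 0 < r) {c : ℝ≥0∞} (hc : c ≠ ∞)
    (hle : ∀ a, 0 ≤ a → a ≤ α k * r / γ k →
      c * μ₀ (Metric.ball 0 a) ≤ μ₀ (Metric.ball ((h k - m k) / γ k) a)) :
    c * productMeasure μ₀ γ m (weightedBall p α (Function.update h k (m k)) r) ≤
      productMeasure μ₀ γ m (weightedBall p α h r) := by
  obtain ⟨a, ha, hint⟩ := exists_measure_weightedBall_update_eq_lintegral hp hα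
    (fun k => μ₀.map (fun u : ℝ => γ k * u + m k)) h k hr
  have h1 := hint (h k)
  rw [Function.update_eq_self] at h1
  rw [productMeasure, h1, hint (m k), ← lintegral_const_mul' _ _ hc]
  refine lintegral_mono fun x => ?_
  have hγk := (hγ k).le
  simp only [map_affine_ball μ₀ (hγ k), sub_self, zero_div]
  exact hle _ (div_nonneg (ha x).1 hγk) (div_le_div_of_nonneg_right (ha x).2 hγk)

end Step

/-! ### Finitely supported shifts of the centre -/

/-- The sequence that agrees with `h` below `M` and with `m` from `M` on. -/
def splice (h m : ℕ → ℝ) (M : ℕ) : ℕ → ℝ := fun k => if k < M then h k else m k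

lemma splice_zero (h m : ℕ → ℝ) : splice h m 0 = m := by
  funext k; simp [splice]

lemma update_splice_succ (h m : ℕ → ℝ) (M : ℕ) :
    Function.update (splice h m (M + 1)) M (m M) = splice h m M := by
  funext k
  rcases eq_or_ne k M with rfl | hk
  · simp [splice]
  · rw [Function.update_of_ne hk]
    have : k < M + 1 ↔ k < M := by omega
    simp [splice, this]

lemma tsum_ite_le_eq (f : ℕ → ℝ≥0∞) (N : ℕ) :
    ∑' j, (if N ≤ j then f j else 0) = ∑' j, f (j + N) := by
  rw [← ENNReal.summable.sum_add_tsum_nat_add' (k := N)]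
  have h0 : ∑ i ∈ Finset.range N, (if N ≤ i then f i else 0) = 0 :=
    Finset.sum_eq_zero fun i hi => if_neg (by simpa using hi)
  rw [h0, zero_add]
  exact tsum_congr fun j => if_pos (by omega)

lemma tendsto_weightedNorm_splice_sub {p : ℝ} (hp : 0 < p) {α h m : ℕ → ℝ}
    (hh : h - m ∈ weightedLp p α) :
    Tendsto (fun M => weightedNorm p α (splice h m M - h)) atTop (𝓝 0) := by
  have hfin := ((mem_weightedLp_iff hp).1 hh).ne
  have hlim := (ENNReal.tendsto_sum_nat_add _ hfin).ennrpow_const (1 / p)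
  rw [ENNReal.zero_rpow_of_pos (by positivity)] at hlim
  refine hlim.congr fun M => ?_
  rw [weightedNorm, ← tsum_ite_le_eq (fun k => ENNReal.ofReal |(h - m) k / α k| ^ p)]
  congr 2
  funext k
  by_cases hk : M ≤ k
  · simp only [hk, if_true, splice, Pi.sub_apply, if_neg (not_lt.2 hk)]
    rw [← abs_neg, ← neg_div, neg_sub]
  · simp [hk, splice, not_le.1 hk, ENNReal.zero_rpow_of_pos hp]

section Chain

variable {p : ℝ} {α γ m h : ℕ → ℝ} {μ₀ : Measure ℝ} [IsProbabilityMeasure μ₀] {d : ℕ → ℝ} {r : ℝ}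

lemma measure_weightedBall_splice_le (hp : 0 < p) (hα : ∀ k, 0 < α k) (hγ : ∀ k, 0 < γ k)
    (hr : 0 < r)
    (hle : ∀ k a, 0 ≤ a → a ≤ α k * r / γ k → μ₀ (Metric.ball ((h k - m k) / γ k) a) ≤
      ENNReal.ofReal (Real.exp (-d k)) * μ₀ (Metric.ball 0 a)) (M : ℕ) :
    productMeasure μ₀ γ m (weightedBall p α (splice h m M) r) ≤
      ENNReal.ofReal (Real.exp (-∑ k ∈ Finset.range M, d k)) *
        productMeasure μ₀ γ m (weightedBall p α m r) := by
  induction M with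
  | zero => simp [splice_zero]
  | succ M ih =>
    have hstep := measure_weightedBall_le_mul_update (μ₀ := μ₀) (m := m) hp hα hγ
      (splice h m (M + 1)) M hr ENNReal.ofReal_ne_top
      (by simpa [splice] using hle M)
    rw [update_splice_succ] at hstep
    refine hstep.trans ((mul_le_mul_right ih _).trans_eq ?_)
    rw [← mul_assoc, ← ENNReal.ofReal_mul (Real.exp_nonneg _), ← Real.exp_add,
      Finset.sum_range_succ, neg_add_rev]

lemma le_measure_weightedBall_splice (hp : 0 < p) (hα : ∀ k, 0 < α k) (hγ : ∀ k, 0 < γ k)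
    (hr : 0 < r)
    (hle : ∀ k a, 0 ≤ a → a ≤ α k * r / γ k →
      ENNReal.ofReal (Real.exp (-d k)) * μ₀ (Metric.ball 0 a) ≤
        μ₀ (Metric.ball ((h k - m k) / γ k) a)) (M : ℕ) :
    ENNReal.ofReal (Real.exp (-∑ k ∈ Finset.range M, d k)) *
        productMeasure μ₀ γ m (weightedBall p α m r) ≤
      productMeasure μ₀ γ m (weightedBall p α (splice h m M) r) := by
  induction M with
  | zero => simp [splice_zero]
  | succ M ih =>
    have hstep := mul_update_le_measure_weightedBall (μ₀ := μ₀) (m := m) hp hα hγ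
      (splice h m (M + 1)) M hr ENNReal.ofReal_ne_top
      (by simpa [splice] using hle M)
    rw [update_splice_succ] at hstep
    refine le_trans ((mul_le_mul_right ih _).trans_eq' ?_) hstep
    rw [← mul_assoc, ← ENNReal.ofReal_mul (Real.exp_nonneg _), ← Real.exp_add,
      Finset.sum_range_succ, neg_add_rev]

end Chain

/-! ### Passing to infinitely supported shifts -/

lemma measure_weightedBall_le_of_splice {p : ℝ} (hp : 1 ≤ p) {α h m : ℕ → ℝ}
    (hh : h - m ∈ weightedLp p α) (μ : Measure (ℕ → ℝ)) {r : ℝ} (hr : 0 < r) {K : ℝ≥0∞}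
    (hK : ∀ᶠ M in atTop, μ (weightedBall p α (splice h m M) r) ≤ K) :
    μ (weightedBall p α h r) ≤ K := by
  rw [← one_mul (μ _)]
  refine mul_measure_weightedBall_le_of_forall_lt hr μ fun r' hr' hlt => ?_
  have hev := (tendsto_weightedNorm_splice_sub (by linarith) hh).eventually_lt_const
    (ENNReal.ofReal_pos.2 (sub_pos.2 hlt))
  obtain ⟨M, hM, hMK⟩ := (hev.and hK).exists
  rw [one_mul]
  refine (measure_mono (weightedBall_subset_of_norm_add_le hp ?_)).trans hMK
  rw [← neg_sub, weightedNorm_neg]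
  calc _ ≤ ENNReal.ofReal (r - r') + ENNReal.ofReal r' := by gcongr
    _ = ENNReal.ofReal r := by rw [← ENNReal.ofReal_add (by linarith) hr'.le, sub_add_cancel]

lemma mul_le_measure_weightedBall_of_splice {p : ℝ} (hp : 1 ≤ p) {α h m : ℕ → ℝ}
    (hh : h - m ∈ weightedLp p α) (μ : Measure (ℕ → ℝ)) {r : ℝ} (hr : 0 < r) {c : ℝ≥0∞}
    (hc : ∀ r', 0 < r' → r' < r → ∀ᶠ M in atTop,
      c * μ (weightedBall p α m r') ≤ μ (weightedBall p α (splice h m M) r')) :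
    c * μ (weightedBall p α m r) ≤ μ (weightedBall p α h r) := by
  refine mul_measure_weightedBall_le_of_forall_lt hr μ fun r' hr' hlt => ?_
  have hev := (tendsto_weightedNorm_splice_sub (by linarith) hh).eventually_lt_const
    (ENNReal.ofReal_pos.2 (sub_pos.2 hlt))
  obtain ⟨M, hM, hMc⟩ := (hev.and (hc r' hr' hlt)).exists
  refine hMc.trans (measure_mono (weightedBall_subset_of_norm_add_le hp ?_))
  calc _ ≤ ENNReal.ofReal (r - r') + ENNReal.ofReal r' := by gcongr
    _ = ENNReal.ofReal r := by rw [← ENNReal.ofReal_add (by linarith) hr'.le, sub_add_cancel]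

/-! ### Positivity of the mass of balls around the centre -/

/-- Some tail of the norm is small with positive probability; the remaining coordinates are then
resampled one after the other. -/
lemma measure_weightedBall_self_pos {p : ℝ} (hp : 0 < p) {α m : ℕ → ℝ} (hα : ∀ k, 0 < α k)
    (ν : ℕ → Measure ℝ) [∀ k, IsProbabilityMeasure (ν k)]
    (hν : ∀ k a, 0 < a → 0 < ν k (Metric.ball (m k) a))
    (hX : Measure.infinitePi ν {x | x - m ∈ weightedLp p α} ≠ 0) {r : ℝ} (hr : 0 < r) :
    0 < Measure.infinitePi ν (weightedBall p α m r) := by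
  set μ := Measure.infinitePi ν
  set R := ENNReal.ofReal r ^ p
  have hR0 : 0 < R := ENNReal.rpow_pos (ENNReal.ofReal_pos.2 hr) ENNReal.ofReal_ne_top
  have hR : R ≠ ∞ := ENNReal.rpow_ne_top_of_nonneg hp.le ENNReal.ofReal_ne_top
  set T : ℕ → (ℕ → ℝ) → ℝ≥0∞ := fun N x =>
    ∑' j, if N ≤ j then ENNReal.ofReal |(x j - m j) / α j| ^ p else 0
  have hTm : ∀ N, Measurable (T N) := fun N => by
    refine measurable_tsum_comp_eval
      (G := fun j y => if N ≤ j then ENNReal.ofReal |(y - m j) / α j| ^ p else 0) fun j => ?_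
    by_cases hj : N ≤ j
    · simp only [hj, if_true]
      fun_prop
    · simp only [hj, if_false]
      exact measurable_const
  have htail : ∃ N, 0 < μ {x | T N x < R} := by
    by_contra! hcon
    refine hX (measure_mono_null ?_ (measure_iUnion_null fun N => le_antisymm (hcon N) zero_le))
    intro x hx
    have hfin := ((mem_weightedLp_iff hp).1 hx).ne
    obtain ⟨N, hN⟩ := ((ENNReal.tendsto_sum_nat_add _ hfin).eventually_lt_const hR0).exists
    refine Set.mem_iUnion.2 ⟨N, ?_⟩
    rw [Set.mem_ofPred_eq]
    simp only [T]
    rw [tsum_ite_le_eq (fun j => ENNReal.ofReal |(x j - m j) / α j| ^ p)]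
    exact hN
  have hstep : ∀ N, 0 < μ {x | T (N + 1) x < R} → 0 < μ {x | T N x < R} := fun N hN => by
    have hmeas : MeasurableSet {x | T N x < R} := measurableSet_lt (hTm N) measurable_const
    have hsec : ∀ x, {y | Function.update x N y ∈ {x | T N x < R}} =
        Metric.ball (m N) (α N * ((R - T (N + 1) x) ^ p⁻¹).toReal) := fun x => by
      rw [← setOf_rpow_lt_eq_ball hp (hα N) (ne_top_of_le_ne_top hR tsub_le_self)]
      ext y
      rw [Set.mem_ofPred_eq, Set.mem_ofPred_eq, Set.mem_ofPred_eq, lt_tsub_iff_right]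
      simp only [T]
      rw [ENNReal.tsum_eq_add_tsum_ite N]
      simp only [le_refl, if_true, Function.update_self]
      refine iff_of_eq (congrArg (fun z => _ + z < _) (tsum_congr fun j => ?_))
      rcases lt_trichotomy j N with hj | rfl | hj
      · simp [hj.ne, not_le.2 hj, show ¬ N + 1 ≤ j by omega]
      · simp
      · simp [hj.ne', hj.le, show N + 1 ≤ j by omega]
    have hle : ∫⁻ x in {x | T (N + 1) x < R},
        ν N (Metric.ball (m N) (α N * ((R - T (N + 1) x) ^ p⁻¹).toReal)) ∂μ ≤
          μ {x | T N x < R} := by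
      rw [infinitePi_eq_lintegral_update ν N hmeas]
      simp only [hsec]
      exact setLIntegral_le_lintegral _ _
    have hpos : ∀ x ∈ {x | T (N + 1) x < R},
        0 < ν N (Metric.ball (m N) (α N * ((R - T (N + 1) x) ^ p⁻¹).toReal)) := fun x hx => by
      have h1 : 0 < R - T (N + 1) x := tsub_pos_of_lt hx
      have h2 : R - T (N + 1) x ≠ ∞ := ne_top_of_le_ne_top hR tsub_le_self
      exact hν N _ (mul_pos (hα N) (ENNReal.toReal_pos (ENNReal.rpow_pos h1 h2).ne'
        (ENNReal.rpow_ne_top_of_nonneg (by positivity) h2)))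
    refine lt_of_lt_of_le ?_ hle
    rw [pos_iff_ne_zero]
    intro h0
    have hmeas' : Measurable fun x =>
        ν N (Metric.ball (m N) (α N * ((R - T (N + 1) x) ^ p⁻¹).toReal)) := by
      simp only [← hsec]
      exact measurable_measure_prodMk_left ((measurePreserving_update ν N).measurable hmeas)
    rw [setLIntegral_eq_zero_iff (measurableSet_lt (hTm _) measurable_const) hmeas'] at h0
    refine hN.ne' (measure_mono_null (fun x hx => ?_) h0)
    exact fun hx0 => (hpos x hx).ne' (hx0 hx)
  obtain ⟨N, hN⟩ := htail
  have h0 : 0 < μ {x | T 0 x < R} := by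
    clear_value T
    induction N with
    | zero => exact hN
    | succ N ih => exact ih (hstep N hN)
  refine lt_of_lt_of_eq h0 (congrArg μ (Set.ext fun x => ?_))
  rw [mem_weightedBall_iff hp]
  simp [T, R]

/-! ### Asymptotic comparison with the centred ball -/

section Density

variable {ρ : ℝ → ℝ} {μ₀ : Measure ℝ}

/-- Continuity of `ρ` controls the mass of small intervals around `t`, relative to those around
`0`, by `exp (-q t)` up to a factor arbitrarily close to `1`. -/
lemma exists_forall_measure_ball_bounds (hc : Continuous ρ) (hpos : ∀ x, 0 < ρ x)
    (hμ₀ : μ₀ = volume.withDensity (fun x => ENNReal.ofReal (ρ x))) (t : ℝ) {ε : ℝ} (hε : 0 < ε) :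
    ∃ δ > 0, ∀ a, 0 ≤ a → a < δ →
      μ₀ (Metric.ball t a) ≤
        ENNReal.ofReal (Real.exp (-(negLogDensity ρ t - ε))) * μ₀ (Metric.ball 0 a) ∧
      ENNReal.ofReal (Real.exp (-(negLogDensity ρ t + ε))) * μ₀ (Metric.ball 0 a) ≤
        μ₀ (Metric.ball t a) := by
  have hcont : ContinuousAt (fun u => ρ (u + t) / ρ u) 0 :=
    ((by fun_prop : Continuous fun u => ρ (u + t)).div hc fun x => (hpos x).ne').continuousAt
  have hlim : Tendsto (fun u => ρ (u + t) / ρ u) (𝓝 0) (𝓝 (Real.exp (-negLogDensity ρ t))) := by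
    rw [exp_neg_negLogDensity hpos]
    simpa [ContinuousAt] using hcont
  have h1 := hlim.eventually_lt_const
    (Real.exp_lt_exp.2 (by linarith : -negLogDensity ρ t < -(negLogDensity ρ t - ε)))
  have h2 := hlim.eventually_const_lt
    (Real.exp_lt_exp.2 (by linarith : -(negLogDensity ρ t + ε) < -negLogDensity ρ t))
  obtain ⟨δ, hδ, hball⟩ := Metric.eventually_nhds_iff.1 (h1.and h2)
  refine ⟨δ, hδ, fun a ha hlt => ?_⟩
  have hu : ∀ u, |u| ≤ a → dist u 0 < δ := fun u hu => by
    rw [Real.dist_0_eq_abs]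
    exact hu.trans_lt hlt
  rw [hμ₀, withDensity_ball hc hpos ha, withDensity_ball hc hpos ha,
    ← ENNReal.ofReal_mul (Real.exp_nonneg _), ← ENNReal.ofReal_mul (Real.exp_nonneg _)]
  exact ⟨ENNReal.ofReal_le_ofReal (intervalMass_le_mul hc ha fun u h =>
      ((div_lt_iff₀ (hpos u)).1 (hball (hu u h)).1).le),
    ENNReal.ofReal_le_ofReal (mul_le_intervalMass hc ha fun u h =>
      ((lt_div_iff₀ (hpos u)).1 (hball (hu u h)).2).le)⟩

/-- For finitely many coordinates the bounds hold simultaneously for all small radii. -/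
lemma eventually_forall_measure_ball_bounds (hc : Continuous ρ) (hpos : ∀ x, 0 < ρ x)
    (hμ₀ : μ₀ = volume.withDensity (fun x => ENNReal.ofReal (ρ x))) (α γ t : ℕ → ℝ)
    (N : ℕ) {ε : ℝ} (hε : 0 < ε) :
    ∀ᶠ r in 𝓝[>] (0 : ℝ), ∀ k < N, ∀ a, 0 ≤ a → a ≤ α k * r / γ k →
      μ₀ (Metric.ball (t k) a) ≤
        ENNReal.ofReal (Real.exp (-(negLogDensity ρ (t k) - ε))) * μ₀ (Metric.ball 0 a) ∧
      ENNReal.ofReal (Real.exp (-(negLogDensity ρ (t k) + ε))) * μ₀ (Metric.ball 0 a) ≤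
        μ₀ (Metric.ball (t k) a) := by
  have hk : ∀ k, ∀ᶠ r in 𝓝[>] (0 : ℝ), ∀ a, 0 ≤ a → a ≤ α k * r / γ k →
      μ₀ (Metric.ball (t k) a) ≤
        ENNReal.ofReal (Real.exp (-(negLogDensity ρ (t k) - ε))) * μ₀ (Metric.ball 0 a) ∧
      ENNReal.ofReal (Real.exp (-(negLogDensity ρ (t k) + ε))) * μ₀ (Metric.ball 0 a) ≤
        μ₀ (Metric.ball (t k) a) := fun k => by
    obtain ⟨δ, hδ, hb⟩ := exists_forall_measure_ball_bounds hc hpos hμ₀ (t k) hε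
    have hlim : Tendsto (fun r : ℝ => α k * r / γ k) (𝓝 0) (𝓝 0) := by
      have : Continuous fun r : ℝ => α k * r / γ k := by fun_prop
      simpa using this.tendsto 0
    filter_upwards [nhdsWithin_le_nhds (hlim.eventually_lt_const hδ)] with r hr a ha hle
    exact hb a ha (hle.trans_lt hr)
  simpa using (eventually_all_finset (Finset.range N)).2 fun k _ => hk k

lemma measure_ball_le_measure_ball_zero (hc : Continuous ρ) (hpos : ∀ x, 0 < ρ x)
    (hs : ∀ x, ρ (-x) = ρ x) (ha : AntitoneOn ρ (Set.Ici 0))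
    (hμ₀ : μ₀ = volume.withDensity (fun x => ENNReal.ofReal (ρ x))) (t : ℝ) {a : ℝ} (ha0 : 0 ≤ a) :
    μ₀ (Metric.ball t a) ≤ μ₀ (Metric.ball 0 a) := by
  rw [hμ₀, withDensity_ball hc hpos ha0, withDensity_ball hc hpos ha0]
  exact ENNReal.ofReal_le_ofReal (intervalMass_le_intervalMass_zero hc hs ha ha0 t)

lemma measure_ball_pos (hc : Continuous ρ) (hpos : ∀ x, 0 < ρ x)
    (hμ₀ : μ₀ = volume.withDensity (fun x => ENNReal.ofReal (ρ x))) (t : ℝ) {a : ℝ} (ha0 : 0 < a) :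
    0 < μ₀ (Metric.ball t a) := by
  rw [hμ₀, withDensity_ball hc hpos ha0.le, ENNReal.ofReal_pos]
  exact intervalIntegral.intervalIntegral_pos_of_pos (hc.intervalIntegrable _ _) hpos (by linarith)

variable [IsProbabilityMeasure μ₀] {p : ℝ} {α γ m h : ℕ → ℝ}

lemma eventually_measure_weightedBall_le (hp : 1 ≤ p) (hα : ∀ k, 0 < α k) (hγ : ∀ k, 0 < γ k)
    (hc : Continuous ρ) (hpos : ∀ x, 0 < ρ x) (hs : ∀ x, ρ (-x) = ρ x)
    (ha : AntitoneOn ρ (Set.Ici 0))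
    (hμ₀ : μ₀ = volume.withDensity (fun x => ENNReal.ofReal (ρ x)))
    (hh : h - m ∈ weightedLp p α) (N : ℕ) {ε : ℝ} (hε : 0 < ε) :
    ∀ᶠ r in 𝓝[>] (0 : ℝ), productMeasure μ₀ γ m (weightedBall p α h r) ≤
      ENNReal.ofReal (Real.exp
          (-(∑ k ∈ Finset.range N, negLogDensity ρ ((h k - m k) / γ k) - ε))) *
        productMeasure μ₀ γ m (weightedBall p α m r) := by
  have hN : (0 : ℝ) < N + 1 := by positivity
  filter_upwards [eventually_forall_measure_ball_bounds hc hpos hμ₀ α γ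
    (fun k => (h k - m k) / γ k) N (div_pos hε hN), self_mem_nhdsWithin] with r hr hr0
  refine measure_weightedBall_le_of_splice hp hh _ hr0 ?_
  filter_upwards [eventually_ge_atTop N] with M hM
  -- the coordinates from `N` on contribute a factor at most `1`
  refine (measure_weightedBall_splice_le (by linarith) hα hγ hr0
    (d := fun k => if k < N then negLogDensity ρ ((h k - m k) / γ k) - ε / (N + 1) else 0)
    (fun k a ha0 hle => ?_) M).trans ?_
  · split_ifs with hk
    · exact (hr k hk a ha0 hle).1
    · simpa using measure_ball_le_measure_ball_zero hc hpos hs ha hμ₀ _ ha0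
  · gcongr
    obtain ⟨j, rfl⟩ := Nat.exists_eq_add_of_le hM
    have hsum : ∑ k ∈ Finset.range N,
        (if k < N then negLogDensity ρ ((h k - m k) / γ k) - ε / (N + 1) else 0) =
        ∑ k ∈ Finset.range N, negLogDensity ρ ((h k - m k) / γ k) - N * (ε / (N + 1)) := by
      rw [Finset.sum_congr rfl fun k hk => if_pos (Finset.mem_range.1 hk)]
      simp
    have hle : N * (ε / (N + 1)) ≤ ε := by
      rw [← mul_div_assoc, div_le_iff₀ hN]
      nlinarith
    rw [Finset.sum_range_add, hsum]
    simp only [not_lt.2 (Nat.le_add_right N _), if_false, Finset.sum_const_zero, add_zero]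
    linarith

lemma summable_negLogDensity (hpos : ∀ x, 0 < ρ x) (hs : ∀ x, ρ (-x) = ρ x)
    (ha : AntitoneOn ρ (Set.Ici 0)) (hh : h ∈ finiteSet ρ γ m) :
    Summable fun k => negLogDensity ρ ((h k - m k) / γ k) := by
  have := ENNReal.summable_toReal (ne_of_lt hh)
  simpa only [ENNReal.toReal_ofReal (negLogDensity_nonneg hpos hs ha _)] using this

lemma toReal_formalNegLogDensity (hpos : ∀ x, 0 < ρ x) (hs : ∀ x, ρ (-x) = ρ x)
    (ha : AntitoneOn ρ (Set.Ici 0)) :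
    (formalNegLogDensity ρ γ m h).toReal = ∑' k, negLogDensity ρ ((h k - m k) / γ k) := by
  rw [formalNegLogDensity, ENNReal.tsum_toReal_eq fun _ => ENNReal.ofReal_ne_top]
  simp only [ENNReal.toReal_ofReal (negLogDensity_nonneg hpos hs ha _)]

lemma summable_sq_div_of_mem_weightedLp_two (hh : h - m ∈ weightedLp 2 γ) :
    Summable fun k => ((h k - m k) / γ k) ^ 2 := by
  have := ENNReal.summable_toReal ((mem_weightedLp_iff two_pos).1 hh).ne
  refine this.congr fun k => ?_
  rw [← ENNReal.toReal_rpow, ENNReal.toReal_ofReal (abs_nonneg _), Real.rpow_two, sq_abs,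
    Pi.sub_apply]

/-- The lower bound for finitely supported shifts, uniformly in the size of the support: the first
`N` coordinates are treated by continuity of `ρ`, the others by the second-order bound. -/
lemma eventually_le_measure_weightedBall_splice (hp : 0 < p) (hα : ∀ k, 0 < α k)
    (hγ : ∀ k, 0 < γ k) (hc : Continuous ρ) (hpos : ∀ x, 0 < ρ x) (hs : ∀ x, ρ (-x) = ρ x)
    (ha : AntitoneOn ρ (Set.Ici 0))
    (hμ₀ : μ₀ = volume.withDensity (fun x => ENNReal.ofReal (ρ x))) (hρ : HasSecondOrderBound ρ)
    (hE : h ∈ finiteSet ρ γ m) (h2 : h - m ∈ weightedLp 2 γ) {ε : ℝ} (hε : 0 < ε) :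
    ∀ᶠ r in 𝓝[>] (0 : ℝ), ∀ᶠ M in atTop,
      ENNReal.ofReal (Real.exp (-((formalNegLogDensity ρ γ m h).toReal + ε))) *
        productMeasure μ₀ γ m (weightedBall p α m r) ≤
      productMeasure μ₀ γ m (weightedBall p α (splice h m M) r) := by
  obtain ⟨C, hC, hbound⟩ := hρ
  set t : ℕ → ℝ := fun k => (h k - m k) / γ k with ht
  set q : ℕ → ℝ := fun k => negLogDensity ρ (t k) with hq
  have hq0 : ∀ k, 0 ≤ q k := fun k => negLogDensity_nonneg hpos hs ha _
  have hqsum : Summable q := summable_negLogDensity hpos hs ha hE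
  have htsum : Summable fun k => t k ^ 2 := summable_sq_div_of_mem_weightedLp_two h2
  set e : ℕ → ℝ := fun k => C * (t k ^ 2 + q k) with he
  have he0 : ∀ k, 0 ≤ e k := fun k => mul_nonneg hC (add_nonneg (sq_nonneg _) (hq0 k))
  have hesum : Summable e := (htsum.add hqsum).mul_left C
  obtain ⟨N, hNt, hNe, hNsum⟩ : ∃ N, (∀ k, N ≤ k → t k ^ 2 < 1) ∧ (∀ k, N ≤ k → e k < 1 / 2) ∧
      ∑' j, e (j + N) < ε / 4 := by
    have h1 := eventually_forall_ge_atTop.2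
      (htsum.tendsto_atTop_zero.eventually_lt_const one_pos)
    have h2 := eventually_forall_ge_atTop.2
      (hesum.tendsto_atTop_zero.eventually_lt_const one_half_pos)
    have h3 := (tendsto_sum_nat_add e).eventually_lt_const (by linarith : 0 < ε / 4)
    exact (h1.and (h2.and h3)).exists
  have hN : (0 : ℝ) < N + 1 := by positivity
  filter_upwards [eventually_forall_measure_ball_bounds hc hpos hμ₀ α γ t N
    (div_pos (half_pos hε) hN), self_mem_nhdsWithin] with r hr hr0
  filter_upwards [eventually_ge_atTop N] with M hM
  -- `exp (-2 e) ≤ 1 - e` for `0 ≤ e ≤ 1 / 2` turns the second-order bound into an exponential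
  refine le_trans ?_ (le_measure_weightedBall_splice hp hα hγ hr0
    (d := fun k => if k < N then q k + ε / 2 / (N + 1) else 2 * e k)
    (fun k a ha0 hle => ?_) M)
  · gcongr
    obtain ⟨j, rfl⟩ := Nat.exists_eq_add_of_le hM
    have hsum : ∑ k ∈ Finset.range N, (if k < N then q k + ε / 2 / (N + 1) else 2 * e k) =
        ∑ k ∈ Finset.range N, q k + N * (ε / 2 / (N + 1)) := by
      rw [Finset.sum_congr rfl fun k hk => if_pos (Finset.mem_range.1 hk),
        Finset.sum_add_distrib]
      simp
    have hle : N * (ε / 2 / (N + 1)) ≤ ε / 2 := by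
      rw [← mul_div_assoc, div_le_iff₀ hN]
      nlinarith
    have hq1 : ∑ k ∈ Finset.range N, q k ≤ (formalNegLogDensity ρ γ m h).toReal := by
      rw [toReal_formalNegLogDensity hpos hs ha]
      exact hqsum.sum_le_tsum _ fun k _ => hq0 k
    have he1 : ∑ i ∈ Finset.range j, 2 * e (N + i) ≤ ε / 2 := by
      rw [← Finset.mul_sum]
      have := ((summable_nat_add_iff N).2 hesum).sum_le_tsum (Finset.range j)
        fun k _ => he0 (k + N)
      simp only [add_comm _ N] at this hNsum
      linarith
    rw [Finset.sum_range_add, hsum]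
    simp only [not_lt.2 (Nat.le_add_right N _), if_false]
    linarith
  · split_ifs with hk
    · exact (hr k hk a ha0 hle).2
    · have hk' := not_lt.1 hk
      have ht1 : |t k| ≤ 1 := (sq_le_one_iff_abs_le_one _).1 (hNt k hk').le
      rw [hμ₀, withDensity_ball hc hpos ha0, withDensity_ball hc hpos ha0,
        ← ENNReal.ofReal_mul (Real.exp_nonneg _)]
      refine ENNReal.ofReal_le_ofReal (le_trans ?_ (hbound (t k) ht1 a ha0))
      refine mul_le_mul_of_nonneg_right ?_ (intervalMass_nonneg hpos ha0 0)
      have hek := hNe k hk'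
      have h0 := he0 k
      change Real.exp (-(2 * e k)) ≤ 1 - e k
      rw [Real.exp_neg, inv_le_comm₀ (Real.exp_pos _) (by linarith)]
      refine le_trans ?_ (Real.add_one_le_exp (2 * e k))
      rw [inv_le_iff_one_le_mul₀ (by linarith)]
      nlinarith

/-- If balls around the truncations of `h` kept a fixed mass while the truncations left every ball
around `m`, mass would escape to infinity. -/
lemma sub_mem_weightedLp_of_le_measure_splice (hp : 1 ≤ p) (μ : Measure (ℕ → ℝ))
    [IsProbabilityMeasure μ] (hX : μ {x | x - m ∈ weightedLp p α} = 1) {r : ℝ} {c : ℝ≥0∞}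
    (hc : 0 < c) (hle : ∀ᶠ M in atTop, c ≤ μ (weightedBall p α (splice h m M) r)) :
    h - m ∈ weightedLp p α := by
  by_contra hh
  have hp0 : 0 < p := by linarith
  have hXU : {x | x - m ∈ weightedLp p α} = ⋃ n : ℕ, weightedBall p α m n := by
    ext x
    rw [Set.mem_iUnion]
    constructor
    · intro hx
      obtain ⟨n, hn⟩ := ENNReal.exists_nat_gt (ne_of_lt hx)
      exact ⟨n, by rwa [weightedBall, Set.mem_ofPred_eq, ENNReal.ofReal_natCast]⟩
    · exact fun ⟨n, hn⟩ =>
        show weightedNorm p α (x - m) < ∞ from lt_of_lt_of_le hn le_top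
  have hmono : Monotone fun n : ℕ => weightedBall p α m n := fun i j hij =>
    weightedBall_mono p α m (by exact_mod_cast hij)
  have hlim := tendsto_measure_iUnion_atTop (μ := μ) hmono
  rw [← hXU, hX] at hlim
  obtain ⟨n, hn⟩ := (hlim.eventually_const_lt
    (ENNReal.sub_lt_self ENNReal.one_ne_top one_ne_zero hc.ne')).exists
  -- the truncations are unbounded because their norms tend to that of `h - m`
  have hfar : Tendsto (fun M => weightedNorm p α (splice h m M - m)) atTop (𝓝 ∞) := by
    rw [mem_weightedLp_iff hp0, not_lt, top_le_iff] at hh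
    have h1 := (ENNReal.tendsto_nat_tsum fun k => ENNReal.ofReal |(h - m) k / α k| ^ p)
    rw [hh] at h1
    have h2 := h1.ennrpow_const (1 / p)
    rw [ENNReal.top_rpow_of_pos (by positivity)] at h2
    refine h2.congr fun M => ?_
    rw [weightedNorm, tsum_eq_sum (s := Finset.range M)]
    · congr 1
      refine Finset.sum_congr rfl fun k hk => ?_
      simp [splice, Finset.mem_range.1 hk]
    · intro k hk
      simp [splice, Finset.mem_range.not.1 hk, ENNReal.zero_rpow_of_pos hp0]
  obtain ⟨M, hM, hcM⟩ := ((hfar.eventually_const_lt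
    (show ENNReal.ofReal r + n < ∞ by simp)).and hle).exists
  have hdisj : Disjoint (weightedBall p α m n) (weightedBall p α (splice h m M) r) := by
    refine Set.disjoint_left.2 fun x hx1 hx2 => hM.not_ge ?_
    rw [weightedBall, Set.mem_ofPred_eq] at hx1 hx2
    rw [← weightedNorm_neg, neg_sub] at hx2
    calc weightedNorm p α (splice h m M - m)
        = weightedNorm p α ((splice h m M - x) + (x - m)) := by congr 1; abel
      _ ≤ weightedNorm p α (splice h m M - x) + weightedNorm p α (x - m) :=
          weightedNorm_add_le hp _ _
      _ ≤ ENNReal.ofReal r + n := by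
          rw [ENNReal.ofReal_natCast] at hx1
          exact add_le_add hx2.le hx1.le
  have hsum := measure_union (μ := μ) hdisj (measurableSet_weightedBall hp0 _ _ _)
  have h1 : μ (weightedBall p α m n) + c ≤ 1 := by
    calc _ ≤ μ (weightedBall p α m n) + μ (weightedBall p α (splice h m M) r) := by gcongr
      _ ≤ 1 := by rw [← hsum]; exact prob_le_one
  have hc1 : c ≤ 1 := le_trans le_add_self h1
  have := ENNReal.le_sub_of_add_le_right (ne_top_of_le_ne_top ENNReal.one_ne_top hc1) h1
  exact absurd hn this.not_gt

lemma eventually_le_measure_weightedBall (hp : 1 ≤ p) (hα : ∀ k, 0 < α k)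
    (hγ : ∀ k, 0 < γ k) (hc : Continuous ρ) (hpos : ∀ x, 0 < ρ x) (hs : ∀ x, ρ (-x) = ρ x)
    (ha : AntitoneOn ρ (Set.Ici 0))
    (hμ₀ : μ₀ = volume.withDensity (fun x => ENNReal.ofReal (ρ x))) (hρ : HasSecondOrderBound ρ)
    (hh : h - m ∈ weightedLp p α)
    (hE : h ∈ finiteSet ρ γ m) (h2 : h - m ∈ weightedLp 2 γ) {ε : ℝ} (hε : 0 < ε) :
    ∀ᶠ r in 𝓝[>] (0 : ℝ),
      ENNReal.ofReal (Real.exp (-((formalNegLogDensity ρ γ m h).toReal + ε))) *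
        productMeasure μ₀ γ m (weightedBall p α m r) ≤
      productMeasure μ₀ γ m (weightedBall p α h r) := by
  have hev := eventually_le_measure_weightedBall_splice (p := p) (by linarith) hα hγ hc hpos hs ha
    hμ₀ hρ hE h2 hε
  obtain ⟨r₀, hr₀, hsub⟩ := mem_nhdsGT_iff_exists_Ioo_subset.1 hev
  filter_upwards [Ioo_mem_nhdsGT hr₀] with r hr
  exact mul_le_measure_weightedBall_of_splice hp hh _ hr.1 fun r' hr' hlt =>
    hsub ⟨hr', hlt.trans hr.2⟩

end Density

/-! ### Negative logarithms of ball ratios -/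

lemma le_negLogBallRatio {p : ℝ} {α h m : ℕ → ℝ} {μ : Measure (ℕ → ℝ)} {r x : ℝ}
    (hle : μ (weightedBall p α h r) ≤
      ENNReal.ofReal (Real.exp (-x)) * μ (weightedBall p α m r)) :
    (x : EReal) ≤ negLogBallRatio p α μ h m r := by
  have h1 := ENNReal.log_monotone (ENNReal.div_le_of_le_mul hle)
  rw [ENNReal.log_ofReal_of_pos (Real.exp_pos _), Real.log_exp, EReal.coe_neg] at h1
  rw [negLogBallRatio]
  exact EReal.le_neg_of_le_neg h1

lemma negLogBallRatio_le {p : ℝ} {α h m : ℕ → ℝ} {μ : Measure (ℕ → ℝ)} {r x : ℝ}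
    (hm0 : μ (weightedBall p α m r) ≠ 0) (hm1 : μ (weightedBall p α m r) ≠ ∞)
    (hle : ENNReal.ofReal (Real.exp (-x)) * μ (weightedBall p α m r) ≤
      μ (weightedBall p α h r)) :
    negLogBallRatio p α μ h m r ≤ (x : EReal) := by
  have h1 := ENNReal.log_monotone ((ENNReal.le_div_iff_mul_le (Or.inl hm0) (Or.inl hm1)).2 hle)
  rw [ENNReal.log_ofReal_of_pos (Real.exp_pos _), Real.log_exp, EReal.coe_neg] at h1
  rw [negLogBallRatio]
  exact EReal.neg_le_of_neg_le h1

lemma tendsto_coe_sum_formalNegLogDensity {ρ : ℝ → ℝ} {γ m h : ℕ → ℝ} (hpos : ∀ x, 0 < ρ x)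
    (hs : ∀ x, ρ (-x) = ρ x) (ha : AntitoneOn ρ (Set.Ici 0)) :
    Tendsto (fun N => ((∑ k ∈ Finset.range N, negLogDensity ρ ((h k - m k) / γ k) : ℝ) : EReal))
      atTop (𝓝 ((formalNegLogDensity ρ γ m h : ℝ≥0∞) : EReal)) := by
  have h1 := (continuous_coe_ennreal_ereal.tendsto _).comp
    (ENNReal.tendsto_nat_tsum fun k => ENNReal.ofReal (negLogDensity ρ ((h k - m k) / γ k)))
  refine h1.congr fun N => ?_
  have h0 : ∀ k, 0 ≤ negLogDensity ρ ((h k - m k) / γ k) := fun k =>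
    negLogDensity_nonneg hpos hs ha _
  rw [Function.comp_apply, ← ENNReal.ofReal_sum_of_nonneg fun k _ => h0 k,
    EReal.coe_ennreal_ofReal, max_eq_left (Finset.sum_nonneg fun k _ => h0 k)]

lemma le_of_forall_pos_coe_sub_le {x : ℝ} {y : EReal}
    (h : ∀ ε : ℝ, 0 < ε → ((x - ε : ℝ) : EReal) ≤ y) : (x : EReal) ≤ y := by
  have hlim : Tendsto (fun ε : ℝ => ((x - ε : ℝ) : EReal)) (𝓝[>] 0) (𝓝 (x : EReal)) := by
    have hcont : Continuous fun ε : ℝ => ((x - ε : ℝ) : EReal) :=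
      continuous_coe_real_ereal.comp (by fun_prop)
    simpa using (hcont.tendsto 0).mono_left nhdsWithin_le_nhds
  exact le_of_tendsto hlim (by filter_upwards [self_mem_nhdsWithin] with ε hε using h ε hε)

lemma le_of_forall_pos_le_coe_add {x : ℝ} {y : EReal}
    (h : ∀ ε : ℝ, 0 < ε → y ≤ ((x + ε : ℝ) : EReal)) : y ≤ (x : EReal) := by
  have hlim : Tendsto (fun ε : ℝ => ((x + ε : ℝ) : EReal)) (𝓝[>] 0) (𝓝 (x : EReal)) := by
    have hcont : Continuous fun ε : ℝ => ((x + ε : ℝ) : EReal) :=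
      continuous_coe_real_ereal.comp (by fun_prop)
    simpa using (hcont.tendsto 0).mono_left nhdsWithin_le_nhds
  exact ge_of_tendsto hlim (by filter_upwards [self_mem_nhdsWithin] with ε hε using h ε hε)

/-- Two-sided exponential bounds, in the form provided by the ball comparisons, determine the limit
of a ratio. -/
lemma tendsto_ratio_of_exp_bounds {l : Filter ℝ} {f g : ℝ → ℝ} {Q : ℝ} (hg : ∀ᶠ r in l, 0 < g r)
    (hup : ∀ ε > 0, ∀ᶠ r in l, f r ≤ Real.exp (-(Q - ε)) * g r)
    (hlow : ∀ ε > 0, ∀ᶠ r in l, Real.exp (-(Q + ε)) * g r ≤ f r) :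
    Tendsto (fun r => f r / g r) l (𝓝 (Real.exp (-Q))) := by
  have hcont : ∀ σ : ℝ, Tendsto (fun ε : ℝ => Real.exp (-(Q + σ * ε))) (𝓝[>] 0)
      (𝓝 (Real.exp (-Q))) := fun σ => by
    have : Continuous fun ε : ℝ => Real.exp (-(Q + σ * ε)) := by fun_prop
    simpa using (this.tendsto 0).mono_left nhdsWithin_le_nhds
  refine tendsto_order.2 ⟨fun a haQ => ?_, fun a haQ => ?_⟩
  · obtain ⟨ε, hε, hε0⟩ :=
      (((hcont 1).eventually_const_lt haQ).and self_mem_nhdsWithin).exists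
    filter_upwards [hg, hlow ε hε0] with r hr hle
    rw [one_mul] at hε
    exact hε.trans_le ((le_div_iff₀ hr).2 hle)
  · obtain ⟨ε, hε, hε0⟩ :=
      (((hcont (-1)).eventually_lt_const haQ).and self_mem_nhdsWithin).exists
    filter_upwards [hg, hup ε hε0] with r hr hle
    rw [neg_one_mul, ← sub_eq_add_neg] at hε
    exact ((div_le_iff₀ hr).2 hle).trans_lt hε

end ProductOM

/-! ### The Onsager–Machlup functional -/

open ProductOM in
theorem mainTheorem1
    (p : ℝ) (hp : 1 ≤ p) (α γ m : ℕ → ℝ) (hα : ∀ k, 0 < α k) (hγ : ∀ k, 0 < γ k)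
    (hm : m ∈ ProductOM.weightedLp p α)
    (ρ : ℝ → ℝ) (hρ_cont : Continuous ρ) (hρ_pos : ∀ x, 0 < ρ x) (hρ_symm : ∀ x, ρ (-x) = ρ x)
    (hρ_anti : AntitoneOn ρ (Set.Ici 0))
    (μ₀ : Measure ℝ) [IsProbabilityMeasure μ₀]
    (hμ₀ : μ₀ = volume.withDensity (fun x => ENNReal.ofReal (ρ x)))
    (hμ : ProductOM.productMeasure μ₀ γ m (ProductOM.weightedLp p α) = 1) :
    (∀ h ∈ ProductOM.weightedLp p α,
      ((ProductOM.formalNegLogDensity ρ γ m h : ℝ≥0∞) : EReal) ≤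
        liminf (ProductOM.negLogBallRatio p α (ProductOM.productMeasure μ₀ γ m) h m) (𝓝[>] 0) ∧
      (h ∉ ProductOM.finiteSet ρ γ m →
        Tendsto (ProductOM.negLogBallRatio p α (ProductOM.productMeasure μ₀ γ m) h m)
          (𝓝[>] 0) (𝓝 ⊤))) ∧
    ((ContDiff ℝ 2 ρ ∧ Integrable (deriv (deriv ρ)) volume) ∨
      (∃ s c : ℝ, 1 ≤ s ∧ s ≤ 2 ∧ ∀ x, ρ x = c * Real.exp (-(|x| ^ s))) →
      (∀ h ∈ ProductOM.finiteSet ρ γ m, h - m ∈ ProductOM.weightedLp 2 γ →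
        h ∈ ProductOM.weightedLp p α ∧
        limsup (ProductOM.negLogBallRatio p α (ProductOM.productMeasure μ₀ γ m) h m) (𝓝[>] 0) ≤
          ((ProductOM.formalNegLogDensity ρ γ m h : ℝ≥0∞) : EReal)) ∧
      ProductOM.IsOnsagerMachlup p α (ProductOM.productMeasure μ₀ γ m)
        (ProductOM.finiteSet ρ γ m ∩ {h | h - m ∈ ProductOM.weightedLp 2 γ})
        (fun h => (ProductOM.formalNegLogDensity ρ γ m h).toReal)) := by
  have hp0 : 0 < p := by linarith
  set μ := productMeasure μ₀ γ m with hμdef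
  have hX : μ {x | x - m ∈ weightedLp p α} = 1 := by
    rw [← hμ]
    congr 1
    ext x
    refine ⟨fun hx => ?_, fun hx => sub_mem_weightedLp hp hx hm⟩
    simpa using add_mem_weightedLp hp hx hm
  have hmpos : ∀ r, 0 < r → 0 < μ (weightedBall p α m r) := fun r hr =>
    measure_weightedBall_self_pos hp0 hα (fun k => μ₀.map (fun u : ℝ => γ k * u + m k))
      (fun k a ha => by
        rw [map_affine_ball μ₀ (hγ k)]
        exact measure_ball_pos hρ_cont hρ_pos hμ₀ _ (div_pos ha (hγ k)))
      (by rw [← productMeasure, ← hμdef, hX]; exact one_ne_zero) hr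
  have hliminf : ∀ h ∈ weightedLp p α, ((formalNegLogDensity ρ γ m h : ℝ≥0∞) : EReal) ≤
      liminf (negLogBallRatio p α μ h m) (𝓝[>] 0) := fun h hh => by
    refine le_of_tendsto' (tendsto_coe_sum_formalNegLogDensity hρ_pos hρ_symm hρ_anti) fun N => ?_
    refine le_of_forall_pos_coe_sub_le fun ε hε => le_liminf_of_le (by isBoundedDefault) ?_
    filter_upwards [eventually_measure_weightedBall_le hp hα hγ hρ_cont hρ_pos hρ_symm hρ_anti hμ₀
      (sub_mem_weightedLp hp hh hm) N hε] with r hr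
    exact le_negLogBallRatio hr
  refine ⟨fun h hh => ⟨hliminf h hh, fun hE => ?_⟩, fun hcases => ?_⟩
  · have htop : formalNegLogDensity ρ γ m h = ∞ := not_lt_top_iff.1 hE
    have h1 := hliminf h hh
    rw [htop, EReal.coe_ennreal_top] at h1
    exact tendsto_of_le_liminf_of_limsup_le h1 le_top
  have hbound : HasSecondOrderBound ρ := by
    rcases hcases with ⟨h2, hint⟩ | ⟨s, c, hs1, hs2, hρ⟩
    · exact hasSecondOrderBound_of_contDiff hρ_pos hρ_symm hρ_anti h2 hint
    · exact hasSecondOrderBound_of_exp_rpow hρ_cont hρ_pos hρ_symm hs1 hs2 hρ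
  have hmem : ∀ h ∈ finiteSet ρ γ m, h - m ∈ weightedLp 2 γ → h - m ∈ weightedLp p α :=
    fun h hE h2 => by
      obtain ⟨r, hr, hr0⟩ := ((eventually_le_measure_weightedBall_splice (p := p) hp0 hα hγ hρ_cont
        hρ_pos hρ_symm hρ_anti hμ₀ hbound hE h2 one_pos).and self_mem_nhdsWithin).exists
      exact sub_mem_weightedLp_of_le_measure_splice hp μ hX
        (ENNReal.mul_pos (ENNReal.ofReal_pos.2 (Real.exp_pos _)).ne' (hmpos r hr0).ne') hr
  have hlow : ∀ h ∈ finiteSet ρ γ m, h - m ∈ weightedLp 2 γ → ∀ ε > 0, ∀ᶠ r in 𝓝[>] (0 : ℝ),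
      ENNReal.ofReal (Real.exp (-((formalNegLogDensity ρ γ m h).toReal + ε))) *
        μ (weightedBall p α m r) ≤ μ (weightedBall p α h r) := fun h hE h2 ε hε =>
    eventually_le_measure_weightedBall hp hα hγ hρ_cont hρ_pos hρ_symm hρ_anti hμ₀ hbound
      (hmem h hE h2) hE h2 hε
  have hspace : ∀ h ∈ finiteSet ρ γ m, h - m ∈ weightedLp 2 γ → h ∈ weightedLp p α :=
    fun h hE h2 => by simpa using add_mem_weightedLp hp (hmem h hE h2) hm
  refine ⟨fun h hE h2 => ⟨hspace h hE h2, ?_⟩, ?_⟩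
  · rw [← ENNReal.ofReal_toReal (ne_of_lt hE), EReal.coe_ennreal_ofReal,
      max_eq_left ENNReal.toReal_nonneg]
    refine le_of_forall_pos_le_coe_add fun ε hε => limsup_le_of_le (by isBoundedDefault) ?_
    filter_upwards [hlow h hE h2 ε hε, self_mem_nhdsWithin] with r hr hr0
    exact negLogBallRatio_le (hmpos r hr0).ne' (measure_ne_top _ _) hr
  have hratio : ∀ h ∈ finiteSet ρ γ m, h - m ∈ weightedLp 2 γ →
      Tendsto (fun r => μ.real (weightedBall p α h r) / μ.real (weightedBall p α m r)) (𝓝[>] 0)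
        (𝓝 (Real.exp (-(formalNegLogDensity ρ γ m h).toReal))) := fun h hE h2 => by
    refine tendsto_ratio_of_exp_bounds ?_ (fun ε hε => ?_) (fun ε hε => ?_)
    · filter_upwards [self_mem_nhdsWithin] with r hr
      exact ENNReal.toReal_pos (hmpos r hr).ne' (measure_ne_top _ _)
    · -- finitely many coordinates carry all but `ε / 2` of the functional
      have hsum := (summable_negLogDensity hρ_pos hρ_symm hρ_anti hE).hasSum.tendsto_sum_nat
      rw [← toReal_formalNegLogDensity hρ_pos hρ_symm hρ_anti] at hsum
      obtain ⟨N, hN⟩ := (hsum.eventually_const_lt (sub_lt_self _ (half_pos hε))).exists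
      filter_upwards [eventually_measure_weightedBall_le hp hα hγ hρ_cont hρ_pos hρ_symm hρ_anti
        hμ₀ (hmem h hE h2) N (half_pos hε)] with r hr
      have hr' := ENNReal.toReal_mono
        (ENNReal.mul_ne_top ENNReal.ofReal_ne_top (measure_ne_top _ _)) hr
      rw [ENNReal.toReal_mul, ENNReal.toReal_ofReal (Real.exp_nonneg _)] at hr'
      refine hr'.trans (mul_le_mul_of_nonneg_right (Real.exp_le_exp.2 ?_) ENNReal.toReal_nonneg)
      linarith
    · filter_upwards [hlow h hE h2 ε hε] with r hr
      have hr' := ENNReal.toReal_mono (measure_ne_top _ _) hr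
      rwa [ENNReal.toReal_mul, ENNReal.toReal_ofReal (Real.exp_nonneg _)] at hr'
  refine ⟨⟨m, ?_, ?_⟩, fun h hh => hspace h hh.1 hh.2, fun x hx r hr => ?_, fun x₁ h₁ x₂ h₂ => ?_⟩
  · have : formalNegLogDensity ρ γ m m = 0 := by
      simp [formalNegLogDensity, negLogDensity, div_self (hρ_pos 0).ne']
    rw [finiteSet, Set.mem_ofPred_eq, this]
    exact ENNReal.zero_lt_top
  · rw [Set.mem_ofPred_eq, sub_self, mem_weightedLp_iff two_pos]
    simp
  · obtain ⟨r', hle, hr'⟩ := ((hlow x hx.1 hx.2 1 one_pos).and (Ioo_mem_nhdsGT hr)).exists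
    refine lt_of_lt_of_le (lt_of_lt_of_le (ENNReal.mul_pos ?_ (hmpos r' hr'.1).ne') hle)
      (measure_mono (weightedBall_mono p α x hr'.2.le))
    exact (ENNReal.ofReal_pos.2 (Real.exp_pos _)).ne'
  · have hdiv := (hratio x₁ h₁.1 h₁.2).div (hratio x₂ h₂.1 h₂.2) (Real.exp_pos _).ne'
    rw [← Real.exp_sub, neg_sub_neg] at hdiv
    refine hdiv.congr' ?_
    filter_upwards [self_mem_nhdsWithin] with r hr
    exact div_div_div_cancel_right₀
      (ENNReal.toReal_pos (hmpos r hr).ne' (measure_ne_top _ _)).ne' _ _
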